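/- Let $D=(V,A)$ be a finite digraph without loops (and without parallel arcs) that is semicomplete, i.e. for any two distinct vertices $x,y$ at least one of $xy,yx$ is an arc. Definitions. $D$ is a comparability digraph if $V$ has a strict total order $\prec$ such that for all $x\prec y\prec z$: $xy,yz\in A$ imply $xz\in A$, and $zy,yx\in A$ imply $zx\in A$. Let $Z_D=\{(x,y): xy\in A \text{ or } yx\in A\}$. For $(x,y),(x',y')\in Z_D$ write $(x,y)\,\Gamma\,(x',y')$ if one of the following holds: (a) $x=x'$ and $y=y'$; (b) $x=x'$, $y\ne y'$, and either $yx,x'y'\in A$ and $yy'\notin A$, or $y'x',xy\in A$ and $y'y\notin A$; (c) $y=y'$, $x\neq x'$, and either $xy,y'x'\in A$ and $xx'\notin A$, or $x'y',yx\in A$ and $x'x\notin A$. The transitive closure $\Gamma^*$ of $\Gamma$ is an equivalence relation on $Z_D$; its equivalence classes are the implication classes of $D$. For a set $I$ of pairs, $I^{-1}=\{(y,x):(x,y)\in I\}$; and $I$ contains a circuit if there are $k\ge 1$ and vertices $x_1,\dots,x_k$ with $(x_1,x_2),(x_2,x_3),\dots,(x_{k-1},x_k),(x_k,x_1)\in I$.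 Pairs $(x,y),(x,z)\in Z_D$ are knotted if there are pairs $(x,y)=(x,y_0)\,\Gamma\,(x,y_1)\,\Gamma\cdots\Gamma\,(x,y_k)=(x,z)$ in $Z_D$, all with first vertex $x$. For each $x$ this equivalence relation partitions the neighbourhood $N(x)=\{y:(x,y)\in Z_D\}$ into classes $x^1,\dots,x^{\ell_x}$. The knotting graph $\tilde K_D$ has as vertices all $x^{\alpha}$ ($x\in V$, $1\le\alpha\le \ell_x$), where classes of different vertices $x$ count as different, and $x^\alpha y^\beta$ is an edge whenever $x\in y^\beta$ and $y\in x^\alpha$. A closed knotting walk of length $p\geq 1$ is a sequence of vertices $x_0,x_1,\dots,x_p=x_0$ such that $(x_i,x_{i-1})$ and $(x_i,x_{i+1})$ are knotted for all $0<i<p$ and also $(x_0,x_{p-1})$ and $(x_0,x_1)$ are knotted; it is odd if $p$ is odd. Theorem. The following statements are equivalent: 1. $D$ is a comparability digraph; 2. the knotting graph $\tilde K_D$ is bipartite; 3. $D$ contains no odd closed knotting walk; 4. $I\neq I^{-1}$ for every implication class $I$ of $D$; 5. no implication class of $D$ contains a circuit. -/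

import Mathlib

/-! Digraphs are Mathlib's `Digraph V`; `D.Adj x y` says that `xy` is an arc of `D`. -/

namespace Digraph

variable {V : Type*}

/-- No vertex has an arc to itself. -/
def IsLoopless (D : Digraph V) : Prop := ∀ x, ¬ D.Adj x x

/-- Any two distinct vertices are joined by at least one arc. -/
def IsSemicomplete (D : Digraph V) : Prop := ∀ x y, x ≠ y → D.Adj x y ∨ D.Adj y x

/-- The strict total order `r` is a comparability ordering of `D`. -/
structure IsComparabilityOrdering (D : Digraph V) (r : V → V → Prop) : Prop where
  strictTotal : IsStrictTotalOrder V r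
  forward : ∀ x y z, r x y → r y z → D.Adj x y → D.Adj y z → D.Adj x z
  backward : ∀ x y z, r x y → r y z → D.Adj z y → D.Adj y x → D.Adj z x

/-- `D` is a comparability digraph. -/
def IsComparability (D : Digraph V) : Prop :=
  ∃ r : V → V → Prop, D.IsComparabilityOrdering r

/-- The set `Z_D` of ordered pairs of adjacent vertices. -/
def pairs (D : Digraph V) : Set (V × V) := {p | D.Adj p.1 p.2 ∨ D.Adj p.2 p.1}

/-- The relation `Γ` on `Z_D`: `p` directly forces `q`. -/
def DirectlyForces (D : Digraph V) (p q : V × V) : Prop :=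
  p ∈ D.pairs ∧ q ∈ D.pairs ∧
    ((p.1 = q.1 ∧ p.2 = q.2) ∨
     (p.1 = q.1 ∧ p.2 ≠ q.2 ∧
        ((D.Adj p.2 p.1 ∧ D.Adj q.1 q.2 ∧ ¬ D.Adj p.2 q.2) ∨
         (D.Adj q.2 q.1 ∧ D.Adj p.1 p.2 ∧ ¬ D.Adj q.2 p.2))) ∨
     (p.2 = q.2 ∧ p.1 ≠ q.1 ∧
        ((D.Adj p.1 p.2 ∧ D.Adj q.2 q.1 ∧ ¬ D.Adj p.1 q.1) ∨
         (D.Adj q.1 q.2 ∧ D.Adj p.2 p.1 ∧ ¬ D.Adj q.1 p.1))))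

/-- The transitive closure `Γ*` of `Γ`. -/
def Forces (D : Digraph V) : V × V → V × V → Prop := Relation.TransGen D.DirectlyForces

/-- The set of implication classes, i.e. of equivalence classes of `Z_D` under `Γ*`. -/
def implicationClasses (D : Digraph V) : Set (Set (V × V)) :=
  {I | ∃ p ∈ D.pairs, I = {q | D.Forces p q}}

/-- The pairs `(x, y)` and `(x, z)` at `x` are knotted: they are joined by a chain of pairs
at `x`, each of which directly forces the next one. (In particular both lie in `Z_D`.) -/
def Knotted (D : Digraph V) (x : V) : V → V → Prop :=
  Relation.TransGen fun y z => D.DirectlyForces (x, y) (x, z)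

/-- The vertices of the knotting graph: a partial copy of `x` is the vertex `x` together with one
of the classes into which knottedness divides the neighbourhood of `x`. -/
def PartialCopy (D : Digraph V) : Type _ :=
  {c : V × Set V // ∃ y, (c.1, y) ∈ D.pairs ∧ c.2 = {z | D.Knotted c.1 y z}}

theorem mem_pairs_of_knotted {D : Digraph V} {x y z : V} (h : D.Knotted x y z) :
    (x, z) ∈ D.pairs := by
  cases h with
  | single h => exact h.2.1
  | tail _ h => exact h.2.1

/-- The knotting graph of a loopless digraph: partial copies of `x` and `y` are adjacent when each
of the vertices `x`, `y` belongs to the class of the other. -/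
def knottingGraph (D : Digraph V) (hD : D.IsLoopless) : SimpleGraph D.PartialCopy where
  Adj u v := v.1.1 ∈ u.1.2 ∧ u.1.1 ∈ v.1.2
  symm := ⟨fun _ _ h => ⟨h.2, h.1⟩⟩
  loopless := ⟨by
    rintro ⟨⟨x, s⟩, y, _, hs⟩ ⟨h, -⟩
    have hs' : s = {z | D.Knotted x y z} := hs
    subst hs'
    exact (mem_pairs_of_knotted h).elim (hD x) (hD x)⟩

/-- The sequence `x 0, x 1, …, x p` is a knotting walk. -/
def IsKnottingWalk (D : Digraph V) (p : ℕ) (x : ℕ → V) : Prop :=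
  ∀ i, i + 1 < p → D.Knotted (x (i + 1)) (x i) (x (i + 2))

/-- The knotting walk `x 0, x 1, …, x p = x 0` (of length `p`) is closed: the walk returns to its
first vertex and the knotting condition also holds there, so that it corresponds to a
closed walk of the knotting graph. -/
def IsClosedKnottingWalk (D : Digraph V) (p : ℕ) (x : ℕ → V) : Prop :=
  D.IsKnottingWalk p x ∧ x p = x 0 ∧ D.Knotted (x 0) (x (p - 1)) (x 1)

end Digraph

/-- The inverse of a set of pairs. -/
def inversePairs {V : Type*} (I : Set (V × V)) : Set (V × V) := {p | (p.2, p.1) ∈ I}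

/-- `I` contains a circuit `(x 0, x 1), (x 1, x 2), …, (x (k - 1), x k)`, `x k = x 0`, of some
length `k ≥ 1`. -/
def ContainsCircuit {V : Type*} (I : Set (V × V)) : Prop :=
  ∃ (k : ℕ) (x : ℕ → V), 1 ≤ k ∧ x k = x 0 ∧ ∀ i < k, (x i, x (i + 1)) ∈ I

/-! A comparability ordering treats all pairs of an implication class alike, which yields a
2-colouring of the knotting graph and excludes circuits. A class equal to its inverse would give a
2-circuit, and a `Γ`-chain from `(x, y)` to `(y, x)` amounts to an odd closed knotting walk; a
2-colouring excludes such chains. The hard implication is from 4 to 1.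

From every two inverse classes one is selected, by comparing the least labels of first vertices.
This makes the selection transitive on triangles of double arcs (`Selected.not_cyclic`), so it is an
`IsLocalOrdering`. It may still contain cycles, but only through free pairs, which no third vertex
constrains.

Free pairs form a strict partial order, and the selected non-free (`Bound`) pairs are acyclic: all
chords of a shortest cycle are free, which transitivity rules out from length five on, while lengths
three and four need a study of arcs (`no_three_cycle`, `no_four_cycle_of_isFree`). Any linear
extension of the bound pairs is then a comparability ordering. -/

namespace Digraph

variable {V : Type*} {D : Digraph V}

/-! ### Free pairs and short cycles in a local ordering. -/

/-- A selection of pairs that behaves locally like a comparability ordering: it picks one of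
`(x, y)`, `(y, x)` for all `x ≠ y`, respects direct forcing, and is transitive on triangles
of pairwise doubly joined vertices. -/
structure IsLocalOrdering (D : Digraph V) (S : V → V → Prop) : Prop where
  semicomplete : ∀ x y, x ≠ y → D.Adj x y ∨ D.Adj y x
  loopless : ∀ x, ¬ D.Adj x x
  total : ∀ x y, x ≠ y → S x y ∨ S y x
  asymm : ∀ x y, S x y → ¬ S y x
  forcing : ∀ a b c, a ≠ c → D.Adj a b → D.Adj b c → ¬ D.Adj a c → (S b a ↔ S b c)
  trans : ∀ a b c, D.Adj a b → D.Adj b a → D.Adj b c → D.Adj c b → D.Adj a c → D.Adj c a →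
    S a b → S b c → S a c

/-- The pair `(x, y)` is free: `xy` is a single arc, and no third vertex forces it. -/
def IsFree (D : Digraph V) (x y : V) : Prop :=
  D.Adj x y ∧ ¬ D.Adj y x ∧ (∀ a, a ≠ y → D.Adj a x → D.Adj a y) ∧
    ∀ a, a ≠ x → D.Adj y a → D.Adj x a

theorem IsFree.trans {x y z : V} (h : D.IsFree x y) (h' : D.IsFree y z) (hl : D.IsLoopless) :
    D.IsFree x z := by
  unfold IsFree IsLoopless at *
  grind

namespace IsLocalOrdering

variable {S : V → V → Prop}

/-- A third vertex witnessing non-freeness is doubly joined to `p` or `r`: otherwise the three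
vertices form a cyclic triangle of single arcs, around which forcing carries a pair to its inverse.
-/
theorem exists_forcing (h : IsLocalOrdering D S) {p r : V} (hpr : D.Adj p r) (hrp : ¬ D.Adj r p)
    (hn : ¬ D.IsFree p r) : ∃ w, w ≠ p ∧ w ≠ r ∧
      ((D.Adj w p ∧ D.Adj p w ∧ D.Adj r w ∧ ¬ D.Adj w r) ∨
        (D.Adj w r ∧ D.Adj r w ∧ D.Adj w p ∧ ¬ D.Adj p w)) := by
  obtain ⟨hs, hl, ht, ha, hf, -⟩ := h
  unfold IsFree at hn
  by_cases h4 : ∀ a, a ≠ r → D.Adj a p → D.Adj a r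
  · have hn' : ¬ ∀ a, a ≠ p → D.Adj r a → D.Adj p a := fun h5 => hn ⟨hpr, hrp, h4, h5⟩
    clear hn
    push Not at hn'
    obtain ⟨w, hw⟩ := hn'
    refine ⟨w, ?_⟩
    clear h4
    have h5 : w ≠ r := by rintro rfl; exact hl _ hw.2.1
    by_cases h6 : D.Adj w r <;> by_cases h7 : D.Adj w p <;> grind
  · clear hn
    push Not at h4
    obtain ⟨w, hw⟩ := h4
    refine ⟨w, ?_⟩
    have h5 : w ≠ p := by rintro rfl; exact hl _ hw.2.1
    by_cases h6 : D.Adj p w <;> by_cases h7 : D.Adj r w <;> grind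

theorem not_cyclic_of_single (h : IsLocalOrdering D S) {p q r : V}
    (hpq : D.Adj p q) (hqp : ¬ D.Adj q p) (hqr : D.Adj q r) (hrq : ¬ D.Adj r q) (hpr : D.Adj p r)
    (hrp : ¬ D.Adj r p) (hn : ¬ D.IsFree p r) : ¬ (S p q ∧ S q r ∧ S r p) ∧
      ¬ (S q p ∧ S r q ∧ S p r) := by
  obtain ⟨w, hwp, hwr, hw⟩ := h.exists_forcing hpr hrp hn
  obtain ⟨hs, hl, ht, ha, hf, htr⟩ := h
  clear hn htr
  by_cases hwq : w = q
  · grind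
  rcases hw with hw | hw
  · rcases hs _ _ hwq with h1 | h1 <;> by_cases h2 : D.Adj q w <;> grind
  · rcases hs _ _ hwq with h1 | h1 <;> by_cases h2 : D.Adj q w <;> grind

theorem not_cyclic_of_double (h : IsLocalOrdering D S) {p q r : V}
    (hpq : D.Adj p q) (hqp : D.Adj q p) (hrp : D.Adj r p) (hpr : ¬ D.Adj p r) (hrq : D.Adj r q)
    (hqr : ¬ D.Adj q r) (hn : ¬ D.IsFree r p) (hn' : ¬ D.IsFree r q) :
    ¬ (S p q ∧ S q r ∧ S r p) := by
  rintro ⟨h1, h2, h3⟩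
  obtain ⟨w, hwr, hwp, hw⟩ := h.exists_forcing hrp hpr hn
  obtain ⟨u, hur, huq, hu⟩ := h.exists_forcing hrq hqr hn'
  obtain ⟨hs, hl, ht, ha, hf, htr⟩ := h
  clear hn hn'
  by_cases hwq : w = q
  · grind
  by_cases hup : u = p
  · grind
  by_cases hwu : w = u
  · grind
  have a1 := hs _ _ hwq
  have a2 := hs _ _ hup
  have a3 := hs _ _ hwu
  -- In the other form `w` is doubly joined to `p` and `q` with `S w p`, hence `S w q`; but `S q r`
  -- forces `S q w`.
  have a4 : D.Adj w r ∧ D.Adj r w ∧ D.Adj p w ∧ ¬ D.Adj w p := by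
    rcases hw with hw | hw
    · exact hw
    · clear hu a2 a3
      have b1 : S w p := by grind
      have b2 : D.Adj w q ∧ D.Adj q w := by grind
      have b3 : S w q := by grind
      grind
  have a5 : D.Adj u r ∧ D.Adj r u ∧ D.Adj q u ∧ ¬ D.Adj u q := by
    rcases hu with hu | hu
    · exact hu
    · clear hw a4 a1 a3
      have b1 : S q u := by grind
      have b2 : D.Adj u p ∧ D.Adj p u := by grind
      have b3 : S p u := by grind
      grind
  clear hw hu
  have b1 : S r w ∧ S p w := by grind
  have b2 : S u r ∧ S u q := by grind
  have b3 : D.Adj u w ∧ D.Adj w u := by grind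
  have b4 : D.Adj u p ∧ ¬ D.Adj p u := by
    by_cases c1 : D.Adj u p <;> by_cases c2 : D.Adj p u <;> grind
  -- The double triangle `u`, `r`, `w` gives `S u w`. The path `w`, `u`, `p` then forces `S u p`,
  -- while the path `u`, `p`, `q` forces `S p u`.
  grind

end IsLocalOrdering

/-- The digraph with all arcs reversed. -/
def reversed (D : Digraph V) : Digraph V := ⟨fun x y => D.Adj y x⟩

theorem isFree_reversed {x y : V} : D.reversed.IsFree x y ↔ D.IsFree y x := by
  unfold IsFree reversed
  tauto

namespace IsLocalOrdering

variable {S : V → V → Prop}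

theorem reversed (h : IsLocalOrdering D S) : IsLocalOrdering D.reversed S where
  semicomplete x y hxy := h.semicomplete y x hxy.symm
  loopless := h.loopless
  total := h.total
  asymm := h.asymm
  forcing a b c hac hab hbc hn := (h.forcing c b a hac.symm hbc hab hn).symm
  trans a b c h1 h2 h3 h4 h5 h6 := h.trans a b c h2 h1 h4 h3 h6 h5

theorem not_cyclic_of_double' (h : IsLocalOrdering D S) {p q r : V}
    (hpq : D.Adj p q) (hqp : D.Adj q p) (hrp : ¬ D.Adj r p) (hpr : D.Adj p r) (hrq : ¬ D.Adj r q)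
    (hqr : D.Adj q r) (hn : ¬ D.IsFree p r) (hn' : ¬ D.IsFree q r) :
    ¬ (S p q ∧ S q r ∧ S r p) :=
  h.reversed.not_cyclic_of_double hqp hpq hpr hrp hqr hrq
    (isFree_reversed.not.2 hn) (isFree_reversed.not.2 hn')

/-- The pairs of a selection that are forced by some third vertex, or doubly joined. -/
def Bound (D : Digraph V) (S : V → V → Prop) (x y : V) : Prop :=
  S x y ∧ ¬ D.IsFree x y ∧ ¬ D.IsFree y x

theorem ne (h : IsLocalOrdering D S) {x y : V} (hxy : S x y) : x ≠ y := by
  rintro rfl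
  exact h.asymm _ _ hxy hxy

theorem arc_cases (h : IsLocalOrdering D S) {x y : V} (hxy : x ≠ y) :
    (D.Adj x y ∧ D.Adj y x) ∨ (D.Adj x y ∧ ¬ D.Adj y x) ∨ (¬ D.Adj x y ∧ D.Adj y x) := by
  have := h.semicomplete x y hxy
  tauto

/-- Forcing alone settles every arc pattern except three double arcs (`trans`), the transitive
triangle of single arcs (`k1`), and one double arc whose ends both receive or both send a single arc
(`k2`, `k3`). -/
theorem no_three_cycle (h : IsLocalOrdering D S) {x y z : V} (hxy : Bound D S x y)
    (hyz : Bound D S y z) (hzx : Bound D S z x) : False := by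
  obtain ⟨s1, f1, g1⟩ := hxy
  obtain ⟨s2, f2, g2⟩ := hyz
  obtain ⟨s3, f3, g3⟩ := hzx
  have n1 := h.ne s1
  have n2 := h.ne s2
  have n3 := h.ne s3
  have k1 := @not_cyclic_of_single V D S h
  have k2 := @not_cyclic_of_double V D S h
  have k3 := @not_cyclic_of_double' V D S h
  rcases h.arc_cases n1 with ⟨a1, b1⟩ | ⟨a1, b1⟩ | ⟨a1, b1⟩ <;>
  rcases h.arc_cases n2 with ⟨a2, b2⟩ | ⟨a2, b2⟩ | ⟨a2, b2⟩ <;>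
  rcases h.arc_cases n3 with ⟨a3, b3⟩ | ⟨a3, b3⟩ | ⟨a3, b3⟩ <;>
  first
  | (have := h.asymm; have := h.forcing; have := h.trans; clear k1 k2 k3; grind only)
  | grind only

/-- The core of the four-cycle case, for a normalised arc pattern. The free diagonals nest
neighbourhoods, so the vertex `w` showing that `a`, `d` is not free also has arcs from `b` and to
`c`; forcing through `w` then contradicts the selection. -/
theorem no_long_cycle (h : IsLocalOrdering D S) {a b c d : V} (hab : S a b) (hcd : S c d)
    (hda : S d a) (hac : D.IsFree a c) (hbd : D.IsFree b d) (had : D.Adj a d)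
    (hda' : ¬ D.Adj d a) (hn : ¬ D.IsFree a d) (h1 : D.Adj a b ∨ ¬ D.Adj d c)
    (h2 : D.Adj c d ∨ ¬ D.Adj b a) : False := by
  obtain ⟨w, hwa, hwd, hw⟩ := h.exists_forcing had hda' hn
  have n1 := h.ne hab
  have n3 := h.ne hcd
  have had0 : d ≠ a := h.ne hda
  obtain ⟨e1, e2, e3, e4⟩ := hac
  obtain ⟨i1, i2, i3, i4⟩ := hbd
  have hwb : w ≠ b := by
    rintro rfl
    exact hw.elim (fun hw => i2 hw.2.2.1) (fun hw => i2 hw.2.1)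
  have hwc : w ≠ c := by
    rintro rfl
    exact hw.elim (fun hw => e2 hw.1) (fun hw => e2 hw.2.2.1)
  have hbw : D.Adj b w := i4 w hwb (hw.elim (·.2.2.1) (·.2.1))
  have hwc' : D.Adj w c := e3 w hwc (hw.elim (·.1) (·.2.2.1))
  have i3w := i3 w hwd
  have e4w := e4 w hwa
  have hs := h.semicomplete
  clear e3 e4 i3 i4 hn
  have t := h.total
  have s := h.asymm
  have f := h.forcing
  rcases hw with ⟨k1, k2, k3, k4⟩ | ⟨k1, k2, k3, k4⟩
  · have hwb' : ¬ D.Adj w b := fun hh => k4 (i3w hh)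
    have hab' : ¬ D.Adj a b := by
      intro hab'
      by_cases hba : D.Adj b a <;> grind only
    have hdc : ¬ D.Adj d c := h1.resolve_left hab'
    have hcd' := (hs _ _ n3).resolve_right hdc
    by_cases hcw : D.Adj c w <;> grind only
  · have hcw : ¬ D.Adj c w := fun hh => k4 (e4w hh)
    have hcd' : ¬ D.Adj c d := by
      intro hcd'
      by_cases hdc : D.Adj d c <;> grind only
    have hba : ¬ D.Adj b a := h2.resolve_left hcd'
    have hab' := (hs _ _ n1).resolve_right hba
    by_cases hwb' : D.Adj w b <;> grind only

theorem flip (h : IsLocalOrdering D S) : IsLocalOrdering D (fun x y => S y x) where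
  semicomplete := h.semicomplete
  loopless := h.loopless
  total x y hxy := h.total y x hxy.symm
  asymm x y := h.asymm y x
  forcing a b c hac hab hbc hn := by
    have h1 : a ≠ b := by rintro rfl; exact h.loopless _ hab
    have h2 : b ≠ c := by rintro rfl; exact h.loopless _ hbc
    have := h.forcing a b c hac hab hbc hn
    have := h.total a b h1
    have := h.total b c h2
    have := h.asymm a b
    have := h.asymm b c
    tauto
  trans a b c h1 h2 h3 h4 h5 h6 h7 h8 := h.trans c b a h4 h3 h2 h1 h6 h5 h8 h7

theorem no_four_cycle_of_isFree (h : IsLocalOrdering D S) {a b c d : V} (hab : Bound D S a b)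
    (hbc : Bound D S b c) (hcd : Bound D S c d) (hda : Bound D S d a) (hac : D.IsFree a c)
    (hbd : D.IsFree b d) : False := by
  have n1 := h.ne hab.1
  have n2 := h.ne hbc.1
  have n3 := h.ne hcd.1
  have n4 := h.ne hda.1
  have s1 := h.semicomplete a b n1
  have s3 := h.semicomplete c d n3
  by_cases hx : (D.Adj a b ∨ ¬ D.Adj d c) ∧ (D.Adj c d ∨ ¬ D.Adj b a)
  · have hda' : ¬ D.Adj d a := by
      intro h1
      have h2 : D.Adj d c := hac.2.2.1 d n3.symm h1
      have h3 : D.Adj b a := hbd.2.2.2 a n1 h1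
      have h4 : D.Adj c d := hx.2.resolve_right (not_not.2 h3)
      have h5 : D.Adj a d := hac.2.2.2 d n4 h4
      have h6 := h.forcing c d a (by rintro rfl; exact h.loopless _ hac.1) h4 h1 hac.2.1
      exact h.asymm _ _ hcd.1 (h6.2 hda.1)
    exact h.no_long_cycle hab.1 hcd.1 hda.1 hac hbd
      ((h.semicomplete d a n4).resolve_left hda') hda' hda.2.2 hx.1 hx.2
  · have hx' : D.Adj b a ∧ D.Adj d c ∧ (¬ D.Adj a b ∨ ¬ D.Adj c d) := by tauto
    have h1 : D.Adj b c := hac.2.2.1 b n2 hx'.1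
    have h2 : ¬ D.Adj c b := fun h2 => hx'.2.2.elim (fun h => h (hac.2.2.2 b n1.symm h2))
      (fun h => h (hbd.2.2.1 c n3 h2))
    exact h.flip.no_long_cycle (a := b) (b := a) (c := d) (d := c) hab.1 hcd.1 hbc.1 hbd hac h1 h2
      hbc.2.1 (Or.inl hx'.1) (Or.inl hx'.2.1)

end IsLocalOrdering

end Digraph

/-! ### Shortest cycles whose chords lie in a strict order. -/

namespace Relation

variable {α : Type*} {r : α → α → Prop}

theorem TransGen.exists_path {a b : α} (h : TransGen r a b) :
    ∃ (k : ℕ) (f : ℕ → α), 1 ≤ k ∧ f 0 = a ∧ f k = b ∧ ∀ i < k, r (f i) (f (i + 1)) := by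
  induction h with
  | single h => exact ⟨1, fun i => if i = 0 then a else _, le_rfl, rfl, rfl, by simpa using h⟩
  | @tail b c _ h ih =>
    obtain ⟨k, f, hk, h0, hb, hf⟩ := ih
    refine ⟨k + 1, fun i => if i ≤ k then f i else c, by omega, by simp [h0], by simp, ?_⟩
    intro i hi
    rcases Nat.lt_succ_iff_lt_or_eq.1 hi with hi | rfl
    · have : i ≤ k := hi.le
      have : i + 1 ≤ k := hi
      simp [*]
    · simpa [hb] using h

/-- On a closed `r`-path of length at least five, a strict order `t` that is disjoint from `r` and
its inverse and compares the ends of every chord cannot orient the chord `f 0`, `f 2` forwards. -/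
theorem no_closed_path_of_chords {t : α → α → Prop} {k : ℕ} {f : ℕ → α}
    (ht : ∀ x y z, t x y → t y z → t x z) (hirr : ∀ x, ¬ t x x)
    (hdisj : ∀ x y, r x y → ¬ t x y ∧ ¬ t y x) (hk : 5 ≤ k) (hclosed : f k = f 0)
    (hf : ∀ i < k, r (f i) (f (i + 1)))
    (hchord : ∀ i j, i + 2 ≤ j → j ≤ k → j + 2 ≤ i + k → t (f i) (f j) ∨ t (f j) (f i)) :
    ¬ t (f 0) (f 2) := by
  intro h02
  -- If instead `t c a`, transitivity gives `t c b`, which `r b c` forbids. So a chord passes its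
  -- orientation on to the next chord at the same end.
  have right : ∀ a b c, t a b → (t a c ∨ t c a) → r b c → t a c := fun a b c hab hac hbc =>
    hac.resolve_right fun hca => (hdisj b c hbc).2 (ht _ _ _ hca hab)
  have left : ∀ a b c, t b a → (t c a ∨ t a c) → r b c → t c a := fun a b c hba hca hbc =>
    hca.resolve_right fun hac => (hdisj b c hbc).1 (ht _ _ _ hba hac)
  have h03 : t (f 0) (f 3) :=
    right _ _ _ h02 (hchord 0 3 (by omega) (by omega) (by omega)) (hf 2 (by omega))
  have h13 : t (f 1) (f 3) :=
    left _ _ _ h03 (hchord 1 3 (by omega) (by omega) (by omega)) (hf 0 (by omega))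
  have h14 : t (f 1) (f 4) :=
    right _ _ _ h13 (hchord 1 4 (by omega) (by omega) (by omega)) (hf 3 (by omega))
  have h24 : t (f 2) (f 4) :=
    left _ _ _ h14 (hchord 2 4 (by omega) (by omega) (by omega)) (hf 1 (by omega))
  have h2 : ∀ j, 4 ≤ j → j ≤ k → t (f 2) (f j) := by
    intro j hj
    induction j, hj using Nat.le_induction with
    | base => exact fun _ => h24
    | succ j hj ih =>
      intro hjk
      exact right _ _ _ (ih (by omega)) (hchord 2 (j + 1) (by omega) hjk (by omega))
        (hf j (by omega))
  -- The propagation has gone once around the cycle, so the chord between `f 0` and `f 2` is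
  -- oriented both ways.
  have h20 := h2 k (by omega) le_rfl
  rw [hclosed] at h20
  exact hirr _ (ht _ _ _ h02 h20)

/-- In a shortest `r`-cycle an `r`-chord in either direction would close a shorter one, so all
chords lie in `t`. -/
theorem transGen_irrefl_of_chords {t : α → α → Prop}
    (ht : ∀ x y z, t x y → t y z → t x z) (hirr : ∀ x, ¬ t x x)
    (hdisj : ∀ x y, r x y → ¬ t x y ∧ ¬ t y x)
    (hcover : ∀ x y, x ≠ y → r x y ∨ r y x ∨ t x y ∨ t y x)
    (hasymm : ∀ x y, r x y → ¬ r y x)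
    (hthree : ∀ x y z, r x y → r y z → ¬ r z x)
    (hfour : ∀ x y z w, r x y → r y z → r z w → r w x → (t x z ∨ t z x) → ¬ (t y w ∨ t w y))
    (a : α) : ¬ TransGen r a a := by
  intro h
  have hex : ∃ k, 1 ≤ k ∧ ∃ f : ℕ → α, f k = f 0 ∧ ∀ i < k, r (f i) (f (i + 1)) := by
    obtain ⟨k, f, hk, h0, h1, hf⟩ := h.exists_path
    exact ⟨k, hk, f, h1.trans h0.symm, hf⟩
  classical
  obtain ⟨hk, f, hclosed, hf⟩ := Nat.find_spec hex
  have hmin : ∀ m, 1 ≤ m → m < Nat.find hex →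
      ¬ ∃ f : ℕ → α, f m = f 0 ∧ ∀ i < m, r (f i) (f (i + 1)) :=
    fun m hm hlt hm' => Nat.find_min hex hlt ⟨hm, hm'⟩
  generalize Nat.find hex = k at *
  have hchord : ∀ i j, i + 2 ≤ j → j ≤ k → j + 2 ≤ i + k → t (f i) (f j) ∨ t (f j) (f i) := by
    intro i j hij hjk hjik
    have hne : f i ≠ f j := by
      intro heq
      refine hmin (j - i) (by omega) (by omega) ⟨fun s => f (i + s), ?_, ?_⟩
      · simp [heq, show i + (j - i) = j by omega]
      · exact fun s hs => hf (i + s) (by omega)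
    have h1 : ¬ r (f j) (f i) := by
      intro hr
      refine hmin (j - i + 1) (by omega) (by omega)
        ⟨fun s => if s ≤ j - i then f (i + s) else f i, by simp, ?_⟩
      intro s hs
      rcases Nat.lt_succ_iff_lt_or_eq.1 hs with hs | rfl
      · have h1 : s ≤ j - i := hs.le
        have h2 : s + 1 ≤ j - i := hs
        simpa only [h1, h2, if_true, add_assoc] using hf (i + s) (by omega)
      · simpa [show i + (j - i) = j by omega] using hr
    have h2 : ¬ r (f i) (f j) := by
      intro hr
      refine hmin (k - (j - i) + 1) (by omega) (by omega)
        -- The shortcut from `f i` to `f j`: the index `s = i + 1` is sent to `j`, which explains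
        -- the `- 1`.
        ⟨fun s => if s ≤ i then f s else f (s + (j - i) - 1), ?_, ?_⟩
      · have h1 : ¬ k - (j - i) + 1 ≤ i := by omega
        have h2 : k - (j - i) + 1 + (j - i) - 1 = k := by omega
        simp [h1, h2, hclosed]
      · intro s hs
        rcases lt_trichotomy s i with hsi | rfl | hsi
        · have h1 : s ≤ i := hsi.le
          have h2 : s + 1 ≤ i := hsi
          simpa only [h1, h2, if_true] using hf s (by omega)
        · have h1 : s + 1 + (j - s) - 1 = j := by omega
          simpa [h1] using hr
        · have h1 : ¬ s ≤ i := by omega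
          have h2 : ¬ s + 1 ≤ i := by omega
          have h3 : s + 1 + (j - i) - 1 = s + (j - i) - 1 + 1 := by omega
          simp only [h1, h2, if_false, h3]
          exact hf _ (by omega)
    have := hcover _ _ hne
    tauto
  obtain hk5 | hk5 := le_or_gt 5 k
  · rcases hchord 0 2 (by omega) (by omega) (by omega) with h02 | h02
    · exact no_closed_path_of_chords ht hirr hdisj hk5 hclosed hf hchord h02
    · exact no_closed_path_of_chords (t := fun x y => t y x) (fun x y z h h' => ht z y x h' h) hirr
        (fun x y hxy => (hdisj x y hxy).symm) hk5 hclosed hf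
        (fun i j h h' h'' => (hchord i j h h' h'').symm) h02
  · have h01 := hf 0 hk
    interval_cases k
    · simp only [zero_add, hclosed] at h01
      exact hasymm _ _ h01 h01
    · have h12 := hf 1 (by omega)
      simp only [Nat.reduceAdd, hclosed] at h12
      exact hasymm _ _ h01 h12
    · have h12 := hf 1 (by omega)
      have h23 := hf 2 (by omega)
      simp only [Nat.reduceAdd, hclosed] at h23
      exact hthree _ _ _ h01 h12 h23
    · have h12 := hf 1 (by omega)
      have h23 := hf 2 (by omega)
      have h34 := hf 3 (by omega)
      simp only [Nat.reduceAdd, hclosed] at h34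
      exact hfour _ _ _ _ h01 h12 h23 h34 (hchord 0 2 (by omega) (by omega) (by omega))
        (hchord 1 3 (by omega) (by omega) (by omega))

end Relation

/-! ### From a local ordering to a comparability ordering. -/

namespace Digraph

variable {V : Type*} {D : Digraph V}

theorem IsLocalOrdering.transGen_bound_irrefl {S : V → V → Prop} (h : IsLocalOrdering D S) (x : V) :
    ¬ Relation.TransGen (IsLocalOrdering.Bound D S) x x := by
  refine Relation.transGen_irrefl_of_chords (r := IsLocalOrdering.Bound D S) (t := D.IsFree)
    (fun x y z h1 h2 => h1.trans h2 h.loopless) (fun x hx => h.loopless x hx.1)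
    (fun x y hxy => hxy.2) ?_ (fun x y h1 h2 => h.asymm _ _ h1.1 h2.1)
    (fun x y z h1 h2 h3 => h.no_three_cycle h1 h2 h3) ?_ x
  · intro x y hxy
    have := h.total x y hxy
    unfold IsLocalOrdering.Bound
    tauto
  · rintro x y z w h1 h2 h3 h4 (h5 | h5) (h6 | h6)
    · exact h.no_four_cycle_of_isFree h1 h2 h3 h4 h5 h6
    · exact h.no_four_cycle_of_isFree h4 h1 h2 h3 h6 h5
    · exact h.no_four_cycle_of_isFree h2 h3 h4 h1 h6 h5
    · exact h.no_four_cycle_of_isFree h3 h4 h1 h2 h5 h6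

/-- A linear extension of the bound pairs agrees with `S` on all non-free pairs. A violation of the
ordering condition at `x`, `y`, `z` makes both `x`, `y` and `y`, `z` non-free, so forcing for `S`
contradicts it. -/
theorem IsLocalOrdering.isComparability {S : V → V → Prop} (h : IsLocalOrdering D S) : D.IsComparability := by
  have hpo : IsPartialOrder V (Relation.ReflTransGen (IsLocalOrdering.Bound D S)) :=
    { refl := fun _ => .refl
      trans := fun _ _ _ => .trans
      antisymm := fun x y hxy hyx => by
        rcases Relation.reflTransGen_iff_eq_or_transGen.1 hxy with rfl | hxy
        · rfl
        · exact (h.transGen_bound_irrefl x (hxy.trans_left hyx)).elim }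
  obtain ⟨s, hs, hle⟩ := extend_partialOrder (Relation.ReflTransGen (IsLocalOrdering.Bound D S))
  have hsL : ∀ x y, IsLocalOrdering.Bound D S x y → s x y := fun x y hxy => hle _ _ (.single hxy)
  have key : ∀ x y z, s x y → x ≠ y → s y z → y ≠ z → (S y x ↔ S y z) →
      ¬ D.IsFree x y → ¬ D.IsFree y x → ¬ D.IsFree y z → ¬ D.IsFree z y → False := by
    intro x y z hxy nxy hyz nyz hf f1 f2 f3 f4
    rcases h.total y x nxy.symm with hyx | hxy'
    · exact nxy (antisymm hxy (hsL _ _ ⟨hyx, f2, f1⟩))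
    · have : S z y := (h.total z y nyz.symm).resolve_right fun hh => h.asymm _ _ hxy' (hf.2 hh)
      exact nyz (antisymm hyz (hsL _ _ ⟨this, f4, f3⟩))
  have hne : ∀ x y z, s x y ∧ x ≠ y → s y z ∧ y ≠ z → x ≠ z := by
    rintro x y _ h1 h2 rfl
    exact h1.2 (antisymm h1.1 h2.1)
  refine ⟨fun x y => s x y ∧ x ≠ y, ?_, ?_, ?_⟩
  · exact
    { trichotomous := fun x y h1 h2 => by
        by_contra hne
        rcases total_of s x y with h3 | h3
        · exact h1 ⟨h3, hne⟩
        · exact h2 ⟨h3, Ne.symm hne⟩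
      irrefl := fun x hx => hx.2 rfl
      trans := fun x y z h1 h2 => ⟨trans_of s h1.1 h2.1, hne x y z h1 h2⟩ }
  · intro x y z h1 h2 axy ayz
    by_contra hn
    have n := hne x y z h1 h2
    exact key x y z h1.1 h1.2 h2.1 h2.2 (h.forcing x y z n axy ayz hn)
      (fun hh => hn (hh.2.2.2 z n.symm ayz)) (fun hh => hh.2.1 axy)
      (fun hh => hn (hh.2.2.1 x n axy)) (fun hh => hh.2.1 ayz)
  · intro x y z h1 h2 azy ayx
    by_contra hn
    have n := hne x y z h1 h2
    exact key x y z h1.1 h1.2 h2.1 h2.2 (h.forcing z y x n.symm azy ayx hn).symm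
      (fun hh => hh.2.1 ayx) (fun hh => hn (hh.2.2.1 z n.symm azy))
      (fun hh => hh.2.1 azy) (fun hh => hn (hh.2.2.2 x n ayx))

/-! ### Implication classes and triangles of double arcs. -/

theorem DirectlyForces.symm {p q : V × V} (h : D.DirectlyForces p q) : D.DirectlyForces q p := by
  obtain ⟨hp, hq, h⟩ := h
  refine ⟨hq, hp, ?_⟩
  rcases h with ⟨h1, h2⟩ | ⟨h1, h2, h3⟩ | ⟨h1, h2, h3⟩
  · exact Or.inl ⟨h1.symm, h2.symm⟩
  · exact Or.inr (Or.inl ⟨h1.symm, h2.symm, h3.symm⟩)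
  · exact Or.inr (Or.inr ⟨h1.symm, h2.symm, h3.symm⟩)

theorem DirectlyForces.swap {p q : V × V} (h : D.DirectlyForces p q) :
    D.DirectlyForces p.swap q.swap := by
  obtain ⟨hp, hq, h⟩ := h
  refine ⟨hp.symm, hq.symm, ?_⟩
  rcases h with ⟨h1, h2⟩ | ⟨h1, h2, h3⟩ | ⟨h1, h2, h3⟩
  · exact Or.inl ⟨h2, h1⟩
  · refine Or.inr (Or.inr ⟨h1, h2, ?_⟩)
    simpa only [Prod.fst_swap, Prod.snd_swap] using h3
  · refine Or.inr (Or.inl ⟨h1, h2, ?_⟩)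
    simpa only [Prod.fst_swap, Prod.snd_swap] using h3

theorem DirectlyForces.of_path {a b c : V} (hac : a ≠ c) (hab : D.Adj a b) (hbc : D.Adj b c)
    (h : ¬ D.Adj a c) : D.DirectlyForces (b, a) (b, c) :=
  ⟨Or.inr hab, Or.inl hbc, Or.inr (Or.inl ⟨rfl, hac, Or.inl ⟨hab, hbc, h⟩⟩)⟩

theorem Forces.symm {p q : V × V} (h : D.Forces p q) : D.Forces q p := by
  induction h with
  | single h => exact .single h.symm
  | tail _ h ih => exact .head h.symm ih

theorem Forces.trans {p q r : V × V} (h : D.Forces p q) (h' : D.Forces q r) : D.Forces p r :=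
  Relation.TransGen.trans h h'

theorem Forces.swap {p q : V × V} (h : D.Forces p q) : D.Forces p.swap q.swap := by
  induction h with
  | single h => exact .single h.swap
  | tail _ h ih => exact .tail ih h.swap

theorem Forces.refl {p : V × V} (h : p ∈ D.pairs) : D.Forces p p :=
  .single ⟨h, h, Or.inl ⟨rfl, rfl⟩⟩

theorem Forces.left_mem {p q : V × V} (h : D.Forces p q) : p ∈ D.pairs := by
  obtain ⟨_, h, -⟩ := Relation.TransGen.head'_iff.1 h
  exact h.1

/-- The set of pairs forced by `(x, y)`. -/
def forcedSet (D : Digraph V) (x y : V) : Set (V × V) := {q | D.Forces (x, y) q}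

theorem Forces.forcedSet_eq {a b c d : V} (h : D.Forces (a, b) (c, d)) :
    D.forcedSet a b = D.forcedSet c d :=
  Set.ext fun _ => ⟨fun h' => h.symm.trans h', fun h' => h.trans h'⟩

theorem forces_iff_forcedSet_eq {a b c d : V} (h : (c, d) ∈ D.pairs) :
    D.Forces (a, b) (c, d) ↔ D.forcedSet a b = D.forcedSet c d :=
  ⟨Forces.forcedSet_eq, fun h' => by
    have : (c, d) ∈ D.forcedSet c d := Forces.refl h
    rwa [← h'] at this⟩

theorem forcedSet_eq_of_path {a b c : V} (hac : a ≠ c) (hab : D.Adj a b) (hbc : D.Adj b c)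
    (h : ¬ D.Adj a c) : D.forcedSet b a = D.forcedSet b c ∧ D.forcedSet a b = D.forcedSet c b :=
  have h1 : D.Forces (b, a) (b, c) := .single (.of_path hac hab hbc h)
  ⟨h1.forcedSet_eq, h1.swap.forcedSet_eq⟩

/-- One `Γ`-step moving `c` to `c'`. A missing arc between `c'` and `a` or `b` would identify two of
the classes assumed different. Only the class labels matter, hence the abstract `κ`. -/
theorem double_triangle_step (hl : D.IsLoopless) (hs : D.IsSemicomplete) {κ : V → V → Set (V × V)}
    (hκ : ∀ a b c, a ≠ c → D.Adj a b → D.Adj b c → ¬ D.Adj a c → κ b a = κ b c ∧ κ a b = κ c b)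
    {a b c c' : V} (hab : D.Adj a b) (hba : D.Adj b a) (hac : D.Adj a c) (hca : D.Adj c a)
    (hbc : D.Adj b c) (hcb : D.Adj c b) (h1 : κ b c ≠ κ a c) (h2 : κ b c ≠ κ b a)
    (h3 : κ a b ≠ κ a c) (hcc : c ≠ c')
    (h : (D.Adj b c' ∧ ¬ D.Adj c c') ∨ (D.Adj c' b ∧ ¬ D.Adj c' c)) :
    D.Adj b c' ∧ D.Adj c' b ∧ D.Adj a c' ∧ D.Adj c' a ∧ κ a c = κ a c' := by
  have n1 : a ≠ c' := by rintro rfl; tauto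
  have n2 : b ≠ c' := by rintro rfl; tauto
  have s1 := hs _ _ n1
  have s2 := hs _ _ n2
  have s3 := hs _ _ hcc
  have k1 := hκ c b c' hcc
  have k1' := hκ c' b c hcc.symm
  have k2 := hκ a b c' n1
  have k2' := hκ c' b a n1.symm
  have k3 := hκ c a c' hcc
  have k3' := hκ c' a c hcc.symm
  have k4 := hκ c c' b (by rintro rfl; exact hl _ hbc)
  have k4' := hκ b c' c (by rintro rfl; exact hl _ hbc)
  have k5 := hκ b a c' n2
  have k5' := hκ c' a b n2.symm
  have k6 := hκ a c' b (by rintro rfl; exact hl _ hab)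
  have k6' := hκ b c' a (by rintro rfl; exact hl _ hab)
  have k7 := hκ a c' c (by rintro rfl; exact hl _ hac)
  have k7' := hκ c c' a (by rintro rfl; exact hl _ hac)
  have k8 := hκ a c c' n1
  have k8' := hκ c' c a n1.symm
  have k9 := hκ b c c' n2
  have k9' := hκ c' c b n2.symm
  clear hκ hs hl
  by_cases d1 : D.Adj b c' <;> by_cases d2 : D.Adj c' b <;> by_cases d3 : D.Adj a c' <;>
    by_cases d4 : D.Adj c' a <;> by_cases d5 : D.Adj c c' <;> by_cases d6 : D.Adj c' c <;>
    grind only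

theorem forcedSet_swap {a b c d : V} (h : (c, d) ∈ D.pairs)
    (heq : D.forcedSet a b = D.forcedSet c d) : D.forcedSet b a = D.forcedSet d c :=
  ((forces_iff_forcedSet_eq h).2 heq).swap.forcedSet_eq

/-- If `a`, `b`, `c` are pairwise doubly joined and the implication classes of their pairs are
suitably different, then every pair of the class of `(b, c)` spans such a triangle with `a`. -/
theorem double_triangle (hl : D.IsLoopless) (hs : D.IsSemicomplete)
    {a b c : V} (hab : D.Adj a b) (hba : D.Adj b a) (hac : D.Adj a c) (hca : D.Adj c a)
    (hbc : D.Adj b c) (hcb : D.Adj c b) (h1 : D.forcedSet b c ≠ D.forcedSet a c)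
    (h2 : D.forcedSet b c ≠ D.forcedSet b a) (h3 : D.forcedSet a b ≠ D.forcedSet a c)
    {q : V × V} (hq : D.Forces (b, c) q) :
    D.Adj a q.1 ∧ D.Adj q.1 a ∧ D.Adj a q.2 ∧ D.Adj q.2 a ∧ D.Adj q.1 q.2 ∧ D.Adj q.2 q.1 ∧
      D.forcedSet a b = D.forcedSet a q.1 ∧ D.forcedSet a c = D.forcedSet a q.2 ∧
      D.forcedSet b c = D.forcedSet q.1 q.2 := by
  have hκ : ∀ a b c, a ≠ c → D.Adj a b → D.Adj b c → ¬ D.Adj a c →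
      D.forcedSet b a = D.forcedSet b c ∧ D.forcedSet a b = D.forcedSet c b :=
    fun a b c h1 h2 h3 h4 => forcedSet_eq_of_path h1 h2 h3 h4
  induction hq.to_reflTransGen with
  | refl => exact ⟨hab, hba, hac, hca, hbc, hcb, rfl, rfl, rfl⟩
  | @tail p q hp hpq ih =>
    obtain ⟨b', c'⟩ := p
    obtain ⟨b'', c''⟩ := q
    obtain ⟨k1, k2, k3, k4, k5, k6, e1, e2, e3⟩ := ih (hq.trans (.single hpq.symm))
    dsimp only at *
    have e1' := forcedSet_swap (Or.inl k1) e1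
    have e2' := forcedSet_swap (Or.inl k3) e2
    rw [e3, e2] at h1
    rw [e3, e1'] at h2
    rw [e1, e2] at h3
    obtain ⟨-, hq', ⟨rfl, rfl⟩ | ⟨rfl, hne, hcase⟩ | ⟨rfl, hne, hcase⟩⟩ := hpq
    · exact ⟨k1, k2, k3, k4, k5, k6, e1, e2, e3⟩
    · obtain ⟨g1, g2, g3, g4, g5⟩ := double_triangle_step hl hs hκ k1 k2 k3 k4 k5 k6 h1 h2 h3 hne
        (by tauto)
      exact ⟨k1, k2, g3, g4, g1, g2, e1, e2.trans g5, hq.forcedSet_eq⟩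
    -- The first vertex moves: the same step with the roles of `b` and `c` exchanged.
    · obtain ⟨g1, g2, g3, g4, g5⟩ := double_triangle_step hl hs hκ k3 k4 k1 k2 k6 k5
        (fun h => h2 (forcedSet_swap (Or.inl k1) h)) (fun h => h1 (forcedSet_swap (Or.inl k4) h))
        h3.symm hne (by tauto)
      exact ⟨g3, g4, k3, k4, g2, g1, e1.trans g5, e2, hq.forcedSet_eq⟩

/-! ### Selecting one of each two inverse classes. -/

/-- The least label of a first vertex of a pair in `K`. -/
noncomputable def minFirst (e : V → ℕ) (K : Set (V × V)) : ℕ := sInf ((fun q => e q.1) '' K)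

/-- Compares sets of pairs by their least first vertex, and otherwise by an arbitrary well-order. -/
def setLT (e : V → ℕ) (K L : Set (V × V)) : Prop :=
  minFirst e K < minFirst e L ∨ (minFirst e K = minFirst e L ∧ WellOrderingRel K L)

/-- Of each two inverse implication classes, select the one which comes first under `setLT`. -/
def Selected (D : Digraph V) (e : V → ℕ) (x y : V) : Prop :=
  x ≠ y ∧ setLT e (D.forcedSet x y) (D.forcedSet y x)

theorem setLT_asymm {e : V → ℕ} {K L : Set (V × V)} (h : setLT e K L) : ¬ setLT e L K := by
  rintro (h' | ⟨h1, h'⟩) <;> rcases h with h | ⟨h2, h⟩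
  · omega
  · omega
  · omega
  · exact asymm_of WellOrderingRel h h'

theorem minFirst_le_of_setLT {e : V → ℕ} {K L : Set (V × V)} (h : setLT e K L) :
    minFirst e K ≤ minFirst e L := by
  rcases h with h | ⟨h, -⟩
  · exact h.le
  · exact h.le

theorem Selected.forcedSet_ne {e : V → ℕ} {x y z w : V} (h : D.Selected e x y)
    (h' : D.Selected e z w) (hw : (w, z) ∈ D.pairs) : D.forcedSet x y ≠ D.forcedSet w z := by
  intro heq
  have h2 := h.2
  rw [forcedSet_swap hw heq, heq] at h2
  exact setLT_asymm h2 h'.2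

theorem exists_minFirst (e : V → ℕ) {x y : V} (h : (x, y) ∈ D.pairs) :
    ∃ q, D.Forces (x, y) q ∧ e q.1 = minFirst e (D.forcedSet x y) := by
  have : ((fun q : V × V => e q.1) '' D.forcedSet x y).Nonempty := ⟨_, _, Forces.refl h, rfl⟩
  exact Nat.sInf_mem this

/-- Around a cyclically selected triangle of pairwise doubly joined vertices, a pair of the class
of `(b, c)` has its first vertex on the side of `b` as seen from `a`. -/
theorem Selected.double_triangle (hl : D.IsLoopless) (hs : D.IsSemicomplete) {e : V → ℕ} {a b c : V}
    (hab : D.Adj a b) (hba : D.Adj b a) (hac : D.Adj a c) (hca : D.Adj c a) (hbc : D.Adj b c)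
    (hcb : D.Adj c b) (sab : D.Selected e a b) (sbc : D.Selected e b c) (sca : D.Selected e c a)
    {q : V × V} (hq : D.Forces (b, c) q) :
    D.Forces (a, b) (a, q.1) ∧ D.Forces (a, c) (a, q.2) := by
  obtain ⟨h1, -, h2, -, -, -, h3, h4, -⟩ := Digraph.double_triangle hl hs hab hba hac hca hbc hcb
    (sbc.forcedSet_ne sca (Or.inl hac)) (sbc.forcedSet_ne sab (Or.inl hba))
    (sab.forcedSet_ne sca (Or.inl hac)) hq
  exact ⟨(forces_iff_forcedSet_eq (Or.inl h1)).2 h3, (forces_iff_forcedSet_eq (Or.inl h2)).2 h4⟩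

/-- The two classes have the same set of first vertices: a pair in either, viewed from the opposite
corner of the triangle, yields a pair in the other with the same first vertex. -/
theorem Selected.minFirst_eq (hl : D.IsLoopless) (hs : D.IsSemicomplete) {e : V → ℕ} {a b c : V}
    (hab : D.Adj a b) (hba : D.Adj b a) (hac : D.Adj a c) (hca : D.Adj c a) (hbc : D.Adj b c)
    (hcb : D.Adj c b) (sab : D.Selected e a b) (sbc : D.Selected e b c) (sca : D.Selected e c a) :
    minFirst e (D.forcedSet b a) = minFirst e (D.forcedSet b c) := by
  unfold minFirst
  congr 1
  apply Set.Subset.antisymm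
  · rintro _ ⟨q, hq, rfl⟩
    have hq' : D.Forces (a, b) q.swap := Forces.swap hq
    exact ⟨_, (Selected.double_triangle hl hs hca hac hcb hbc hab hba sca sab sbc hq').2.swap, rfl⟩
  · rintro _ ⟨q, hq, rfl⟩
    exact ⟨_, (Selected.double_triangle hl hs hab hba hac hca hbc hcb sab sbc sca hq).1.swap, rfl⟩

/-- Around a cyclic triangle the minima satisfy a closed chain of equalities and inequalities, so
all coincide. By injectivity one vertex `v` starts pairs of both `(a, b)` and `(b, a)`. Seen from
`c`, both `(c, a)` and `(c, b)` then force `(c, v)`, although `(c, a)` and `(b, c)` are selected. -/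
theorem Selected.not_cyclic (hl : D.IsLoopless) (hs : D.IsSemicomplete) {e : V → ℕ}
    (he : Function.Injective e) {a b c : V}
    (hab : D.Adj a b) (hba : D.Adj b a) (hac : D.Adj a c) (hca : D.Adj c a) (hbc : D.Adj b c)
    (hcb : D.Adj c b) (sab : D.Selected e a b) (sbc : D.Selected e b c) : ¬ D.Selected e c a := by
  intro sca
  have m1 := Selected.minFirst_eq hl hs hab hba hac hca hbc hcb sab sbc sca
  have m2 := Selected.minFirst_eq hl hs hbc hcb hba hab hca hac sbc sca sab
  have m3 := Selected.minFirst_eq hl hs hca hac hcb hbc hab hba sca sab sbc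
  have l1 := minFirst_le_of_setLT sab.2
  have l2 := minFirst_le_of_setLT sbc.2
  have l3 := minFirst_le_of_setLT sca.2
  obtain ⟨q, hq, hq'⟩ := exists_minFirst (D := D) e (Or.inl hab : (a, b) ∈ D.pairs)
  obtain ⟨r, hr, hr'⟩ := exists_minFirst (D := D) e (Or.inl hba : (b, a) ∈ D.pairs)
  have hqr : q.1 = r.1 := he (by omega)
  have g1 := (Selected.double_triangle hl hs hca hac hcb hbc hab hba sca sab sbc hq).1
  have g2 := (Selected.double_triangle hl hs hca hac hcb hbc hab hba sca sab sbc hr.swap).2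
  simp only [Prod.snd_swap] at g2
  rw [hqr] at g1
  exact sca.forcedSet_ne sbc (Or.inl hcb) (g1.trans g2.symm).forcedSet_eq

theorem selected_total (hs : D.IsSemicomplete) (e : V → ℕ)
    (hI : ∀ x y, ¬ D.Forces (x, y) (y, x)) {x y : V} (hxy : x ≠ y) :
    D.Selected e x y ∨ D.Selected e y x := by
  have hne : D.forcedSet x y ≠ D.forcedSet y x := fun h =>
    hI x y ((forces_iff_forcedSet_eq (hs y x hxy.symm)).2 h)
  unfold Selected setLT
  rcases lt_trichotomy (minFirst e (D.forcedSet x y)) (minFirst e (D.forcedSet y x)) with h | h | h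
  · exact Or.inl ⟨hxy, Or.inl h⟩
  · rcases trichotomous_of WellOrderingRel (D.forcedSet x y) (D.forcedSet y x) with h' | h' | h'
    · exact Or.inl ⟨hxy, Or.inr ⟨h, h'⟩⟩
    · exact (hne h').elim
    · exact Or.inr ⟨hxy.symm, Or.inr ⟨h.symm, h'⟩⟩
  · exact Or.inr ⟨hxy.symm, Or.inl h⟩

theorem isLocalOrdering_selected (hl : D.IsLoopless) (hs : D.IsSemicomplete) {e : V → ℕ}
    (he : Function.Injective e) (hI : ∀ x y, ¬ D.Forces (x, y) (y, x)) :
    IsLocalOrdering D (D.Selected e) where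
  semicomplete := hs
  loopless := hl
  total _ _ := selected_total hs e hI
  asymm x y h h' := setLT_asymm h.2 h'.2
  forcing a b c hac hab hbc hn := by
    obtain ⟨h1, h2⟩ := forcedSet_eq_of_path hac hab hbc hn
    have n1 : b ≠ a := by rintro rfl; exact hl _ hab
    have n2 : b ≠ c := by rintro rfl; exact hl _ hbc
    simp only [Selected, h1, h2, n1, n2, ne_eq, not_false_eq_true]
  trans a b c hab hba hbc hcb hac hca sab sbc := by
    have hne : a ≠ c := by rintro rfl; exact hl _ hac
    exact (selected_total hs e hI hne).resolve_right
      (Selected.not_cyclic hl hs he hab hba hac hca hbc hcb sab sbc)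

theorem isComparability_of_forall_not_forces [Finite V] (hl : D.IsLoopless) (hs : D.IsSemicomplete)
    (hI : ∀ x y, ¬ D.Forces (x, y) (y, x)) : D.IsComparability := by
  obtain ⟨n, ⟨e⟩⟩ := Finite.exists_equiv_fin V
  exact (isLocalOrdering_selected hl hs (Fin.val_injective.comp e.injective) hI).isComparability

theorem forall_ne_inversePairs_iff :
    (∀ I ∈ D.implicationClasses, I ≠ inversePairs I) ↔ ∀ x y, ¬ D.Forces (x, y) (y, x) := by
  constructor
  · intro h x y hxy
    refine h _ ⟨(x, y), hxy.left_mem, rfl⟩ (Set.ext fun q => ?_)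
    exact ⟨fun hq => hxy.trans (Forces.swap hq), fun hq => hxy.trans (Forces.swap hq)⟩
  · rintro h _ ⟨⟨x, y⟩, hp, rfl⟩ heq
    have : (x, y) ∈ inversePairs {q | D.Forces (x, y) q} := heq ▸ Forces.refl hp
    exact h x y this

/-! ### Consequences of a comparability ordering. -/

namespace IsComparabilityOrdering

variable {r : V → V → Prop}

theorem iff_of_path (h : D.IsComparabilityOrdering r) {a b c : V} (hab' : a ≠ b) (hbc' : b ≠ c)
    (hab : D.Adj a b) (hbc : D.Adj b c) (hn : ¬ D.Adj a c) : r b a ↔ r b c := by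
  have := h.strictTotal
  have h1 := h.forward a b c
  have h2 := h.backward c b a
  have h3 := trichotomous_of r a b
  have h4 := trichotomous_of r b c
  have h5 : ∀ x y, r x y → ¬ r y x := fun x y hxy hyx => asymm_of r hxy hyx
  have h6 := h5 a b
  have h7 := h5 b c
  tauto

theorem rel_swap_iff (h : D.IsComparabilityOrdering r) {x y : V} (hxy : x ≠ y) :
    r y x ↔ ¬ r x y := by
  have := h.strictTotal
  constructor
  · exact fun h1 h2 => asymm_of r h1 h2
  · intro h1
    rcases trichotomous_of r x y with h2 | h2 | h2
    · exact (h1 h2).elim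
    · exact (hxy h2).elim
    · exact h2

theorem rel_iff_of_directlyForces (hl : D.IsLoopless) (h : D.IsComparabilityOrdering r)
    {p q : V × V} (hpq : D.DirectlyForces p q) : r p.1 p.2 ↔ r q.1 q.2 := by
  have hne : ∀ x y, D.Adj x y → x ≠ y := by
    rintro x _ hxy rfl
    exact hl x hxy
  obtain ⟨x, y⟩ := p
  obtain ⟨x', y'⟩ := q
  obtain ⟨-, -, ⟨h1, h2⟩ | ⟨h1, -, ⟨h2, h3, h4⟩ | ⟨h2, h3, h4⟩⟩ |
    ⟨h1, -, ⟨h2, h3, h4⟩ | ⟨h2, h3, h4⟩⟩⟩ := hpq <;> dsimp only at h1 h2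
  · subst h1 h2; rfl
  · subst h1
    exact h.iff_of_path (hne _ _ h2) (hne _ _ h3) h2 h3 h4
  · subst h1
    exact (h.iff_of_path (hne _ _ h2) (hne _ _ h3) h2 h3 h4).symm
  · subst h1
    dsimp only at *
    rw [h.rel_swap_iff (hne _ _ h2).symm, h.rel_swap_iff (hne _ _ h3),
      h.iff_of_path (hne _ _ h2) (hne _ _ h3) h2 h3 h4]
  · subst h1
    dsimp only at *
    rw [h.rel_swap_iff (hne _ _ h3), h.rel_swap_iff (hne _ _ h2).symm,
      h.iff_of_path (hne _ _ h2) (hne _ _ h3) h2 h3 h4]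

theorem rel_iff_of_forces (hl : D.IsLoopless) (h : D.IsComparabilityOrdering r)
    {p q : V × V} (hpq : D.Forces p q) : r p.1 p.2 ↔ r q.1 q.2 := by
  induction hpq with
  | single hpq => exact h.rel_iff_of_directlyForces hl hpq
  | tail _ hpq ih => exact ih.trans (h.rel_iff_of_directlyForces hl hpq)

end IsComparabilityOrdering

theorem Forces.right_mem {p q : V × V} (h : D.Forces p q) : q ∈ D.pairs := h.symm.left_mem

theorem mem_pairs_comm {x y : V} (h : (x, y) ∈ D.pairs) : (y, x) ∈ D.pairs := h.symm

theorem ne_of_mem_pairs (hl : D.IsLoopless) {x y : V} (h : (x, y) ∈ D.pairs) : x ≠ y := by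
  rintro rfl
  exact h.elim (hl x) (hl x)

theorem IsComparability.not_containsCircuit (hl : D.IsLoopless) (h : D.IsComparability)
    {I : Set (V × V)} (hI : I ∈ D.implicationClasses) : ¬ ContainsCircuit I := by
  obtain ⟨r, hr⟩ := h
  obtain ⟨p, hp, rfl⟩ := hI
  rintro ⟨k, x, hk, hclosed, hx⟩
  have := hr.strictTotal
  have hiff : ∀ i < k, (r p.1 p.2 ↔ r (x i) (x (i + 1))) := fun i hi =>
    hr.rel_iff_of_forces hl (hx i hi)
  have chain : ∀ s : V → V → Prop, (∀ x y z, s x y → s y z → s x z) →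
      (∀ i < k, s (x i) (x (i + 1))) → s (x 0) (x k) := by
    intro s hs h1
    clear hclosed hx hiff
    induction k, hk using Nat.le_induction with
    | base => exact h1 0 (by omega)
    | succ k hk ih => exact hs _ _ _ (ih fun i hi => h1 i (by omega)) (h1 k (by omega))
  by_cases hrp : r p.1 p.2
  · have := chain r (fun _ _ _ => trans_of r) fun i hi => (hiff i hi).1 hrp
    rw [hclosed] at this
    exact irrefl_of r _ this
  · have := chain (fun x y => r y x) (fun _ _ _ h h' => trans_of r h' h) fun i hi =>
      (hr.rel_swap_iff (ne_of_mem_pairs hl (Forces.right_mem (hx i hi)))).2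
        fun h => hrp ((hiff i hi).2 h)
    rw [hclosed] at this
    exact irrefl_of r _ this

/-! ### Knotting graph and knotting walks. -/

theorem Knotted.forces {x y z : V} (h : D.Knotted x y z) : D.Forces (x, y) (x, z) :=
  Relation.TransGen.lift (fun y => (x, y)) (fun _ _ h => h) _ _ h

theorem Knotted.symm {x y z : V} (h : D.Knotted x y z) : D.Knotted x z y := by
  induction h with
  | single h => exact .single h.symm
  | tail _ h ih => exact .head h.symm ih

theorem Knotted.refl {x y : V} (h : (x, y) ∈ D.pairs) : D.Knotted x y y :=
  .single ⟨h, h, Or.inl ⟨rfl, rfl⟩⟩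

theorem IsComparability.isBipartite (hl : D.IsLoopless) (h : D.IsComparability) :
    (D.knottingGraph hl).IsBipartite := by
  classical
  obtain ⟨r, hr⟩ := h
  have key : ∀ (u : D.PartialCopy) (y : V), y ∈ u.1.2 → ((∃ z ∈ u.1.2, r u.1.1 z) ↔ r u.1.1 y) := by
    rintro ⟨⟨x, s⟩, w, hw, hs⟩ y hy
    dsimp only at hw hs hy ⊢
    subst hs
    refine ⟨?_, fun h => ⟨y, hy, h⟩⟩
    rintro ⟨z, hz, hxz⟩
    exact (hr.rel_iff_of_forces hl
      ((Knotted.forces hz).symm.trans (Knotted.forces hy))).1 hxz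
  -- A copy of `x` is coloured by whether `x` precedes the vertices of its class; by `key` one
  -- member decides.
  refine ⟨SimpleGraph.Coloring.mk
    (fun u => if ∃ z ∈ u.1.2, r u.1.1 z then (0 : Fin 2) else 1) ?_⟩
  rintro u v ⟨h1, h2⟩
  have hne : u.1.1 ≠ v.1.1 := by
    obtain ⟨⟨x, s⟩, w, hw, hs⟩ := u
    dsimp only at hw hs h1 ⊢
    subst hs
    exact ne_of_mem_pairs hl (mem_pairs_of_knotted h1)
  simp only [key u _ h1, key v _ h2, hr.rel_swap_iff hne]
  by_cases h : r u.1.1 v.1.1 <;> simp [h]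

/-- The partial copy of `x` whose class contains `y`. -/
def partialCopy {x y : V} (h : (x, y) ∈ D.pairs) : D.PartialCopy :=
  ⟨(x, {z | D.Knotted x y z}), y, h, rfl⟩

theorem partialCopy_eq {x y z : V} (h : (x, y) ∈ D.pairs) (h' : (x, z) ∈ D.pairs)
    (hk : D.DirectlyForces (x, y) (x, z)) : partialCopy h = partialCopy h' := by
  have hyz : D.Knotted x y z := .single hk
  refine Subtype.ext (Prod.ext rfl (Set.ext fun w => ?_))
  exact ⟨fun hw => Relation.TransGen.trans hyz.symm hw, fun hw => Relation.TransGen.trans hyz hw⟩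

/-- Give a pair `(x, y)` the colour of the copy of `x` containing `y`. This is constant along `Γ`
and changes under inversion; steps at the second vertex need that there are only two colours. -/
theorem not_forces_of_isBipartite (hl : D.IsLoopless) (h : (D.knottingGraph hl).IsBipartite)
    (x y : V) : ¬ D.Forces (x, y) (y, x) := by
  obtain ⟨C⟩ := h
  have hswap : ∀ p (hp : p ∈ D.pairs), C (partialCopy (x := p.1) (y := p.2) hp) ≠
      C (partialCopy (x := p.2) (y := p.1) hp.symm) := fun p hp =>
    C.valid ⟨Knotted.refl hp, Knotted.refl hp.symm⟩
  have hstep : ∀ p q (hp : p ∈ D.pairs) (hq : q ∈ D.pairs), D.DirectlyForces p q →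
      C (partialCopy (x := p.1) (y := p.2) hp) = C (partialCopy (x := q.1) (y := q.2) hq) := by
    rintro ⟨a, b⟩ ⟨c, d⟩ hp hq hpq
    have hd := hpq
    obtain ⟨-, -, ⟨h1, h2⟩ | ⟨h1, -⟩ | ⟨h1, -⟩⟩ := hpq
    · dsimp only at h1 h2
      subst h1 h2
      rfl
    · dsimp only at h1
      subst h1
      exact congrArg C (partialCopy_eq hp hq hd)
    · dsimp only at h1
      subst h1
      have h2 := hswap _ hp
      have h3 := hswap _ hq
      have h4 := congrArg C (partialCopy_eq (mem_pairs_comm hp) (mem_pairs_comm hq) hd.swap)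
      dsimp only at h2 h3 ⊢
      rw [h4] at h2
      generalize C (partialCopy hp) = i at *
      generalize C (partialCopy hq) = j at *
      generalize C (partialCopy _) = k at *
      omega
  have hall : ∀ q, D.Forces (x, y) q → ∀ (hp : (x, y) ∈ D.pairs) (hq : q ∈ D.pairs),
      C (partialCopy hp) = C (partialCopy (x := q.1) (y := q.2) hq) := by
    intro q hq
    induction hq with
    | single h => exact fun hp hq => hstep _ _ hp hq h
    | tail _ h ih => exact fun hp hq => (ih hp h.1).trans (hstep _ _ h.1 hq h)
  intro hxy
  exact hswap _ hxy.left_mem (hall _ hxy hxy.left_mem hxy.right_mem)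

theorem DirectlyForces.knotted {u v u' v' : V} (h : D.DirectlyForces (u, v) (u', v')) :
    D.Knotted v u u' ∧ D.Knotted u' v v' := by
  have hd := h
  obtain ⟨h1, h2, ⟨rfl, rfl⟩ | ⟨rfl, -⟩ | ⟨rfl, -⟩⟩ := h
  · exact ⟨.refl h1.symm, .refl h1⟩
  · exact ⟨.refl h1.symm, .single hd⟩
  · exact ⟨.single hd.swap, .refl h2⟩

/-- Each `Γ`-step appends both vertices of the new pair, the unchanged one being trivially knotted
with itself. The length therefore stays odd. -/
theorem exists_knottingWalk {x y : V} {q : V × V} (h : D.Forces (x, y) q) :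
    ∃ (n : ℕ) (z : ℕ → V), z 0 = x ∧ z 1 = y ∧ z (2 * n) = q.1 ∧ z (2 * n + 1) = q.2 ∧
      D.IsKnottingWalk (2 * n + 1) z := by
  induction h.to_reflTransGen with
  | refl =>
    exact ⟨0, fun i => if i = 0 then x else y, rfl, rfl, rfl, rfl, fun i hi => by omega⟩
  | @tail p q _ hpq ih =>
    obtain ⟨u, v⟩ := p
    obtain ⟨u', v'⟩ := q
    obtain ⟨n, z, h0, h1, h2, h3, hz⟩ := ih (h.trans (.single hpq.symm))
    obtain ⟨k1, k2⟩ := hpq.knotted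
    dsimp only at h2 h3 ⊢
    have hold : ∀ i ≤ 2 * n + 1,
        (if i ≤ 2 * n + 1 then z i else if i = 2 * n + 2 then u' else v') = z i :=
      fun i hi => if_pos hi
    refine ⟨n + 1, fun i => if i ≤ 2 * n + 1 then z i else if i = 2 * n + 2 then u' else v',
      by simpa using h0, by simpa using h1, ?_, ?_, fun i hi => ?_⟩
    · simp [Nat.mul_add]
    · simp [Nat.mul_add]
    · rcases lt_trichotomy i (2 * n) with hlt | rfl | hgt
      · simp only [hold i (by omega), hold (i + 1) (by omega), hold (i + 2) (by omega)]
        exact hz i (by omega)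
      · simpa [h2, h3] using k1
      · obtain rfl : i = 2 * n + 1 := by omega
        simpa [h3] using k2

/-- Two knottings carry `(x i, x (i + 1))` to `(x (i + 2), x (i + 3))`; since `p` is odd, going once
around reverses the initial pair. -/
theorem forces_of_closedKnottingWalk {p : ℕ} {x : ℕ → V} (hp : Odd p)
    (h : D.IsClosedKnottingWalk p x) : D.Forces (x 0, x 1) (x 1, x 0) := by
  obtain ⟨n, rfl⟩ := hp
  obtain ⟨hw, hclosed, hend⟩ := h
  have h0 : (x 0, x 1) ∈ D.pairs := mem_pairs_of_knotted hend
  have key : ∀ j ≤ n, D.Forces (x 0, x 1) (x (2 * j), x (2 * j + 1)) := by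
    intro j hj
    induction j with
    | zero => exact Forces.refl h0
    | succ j ih =>
      have h1 := (hw (2 * j) (by omega)).forces.swap
      have h2 := (hw (2 * j + 1) (by omega)).forces
      exact ((ih (by omega)).trans h1).trans h2
  have h1 := key n le_rfl
  rw [hclosed] at h1
  exact h1.trans hend.forces.swap

end Digraph

theorem mainTheorem1 {V : Type*} [Finite V] (D : Digraph V)
    (hloop : D.IsLoopless) (hD : D.IsSemicomplete) :
    List.TFAE
      [D.IsComparability,
       (D.knottingGraph hloop).IsBipartite,
       ¬ ∃ (p : ℕ) (x : ℕ → V), Odd p ∧ D.IsClosedKnottingWalk p x,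
       ∀ I ∈ D.implicationClasses, I ≠ inversePairs I,
       ∀ I ∈ D.implicationClasses, ¬ ContainsCircuit I] := by
  tfae_have 1 → 2 := fun h => h.isBipartite hloop
  tfae_have 2 → 4 := fun h =>
    Digraph.forall_ne_inversePairs_iff.2 (Digraph.not_forces_of_isBipartite hloop h)
  tfae_have 4 → 1 := fun h => Digraph.isComparability_of_forall_not_forces hloop hD
    (Digraph.forall_ne_inversePairs_iff.1 h)
  tfae_have 1 → 5 := fun h I hI => h.not_containsCircuit hloop hI
  tfae_have 5 → 4 := by
    refine fun h => Digraph.forall_ne_inversePairs_iff.2 fun x y hxy => ?_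
    refine h _ ⟨(x, y), hxy.left_mem, rfl⟩
      ⟨2, fun i => if i % 2 = 0 then x else y, by omega, rfl, fun i hi => ?_⟩
    interval_cases i
    · exact Digraph.Forces.refl hxy.left_mem
    · exact hxy
  tfae_have 4 → 3 := by
    rintro h ⟨p, x, hp, hx⟩
    exact Digraph.forall_ne_inversePairs_iff.1 h _ _ (Digraph.forces_of_closedKnottingWalk hp hx)
  tfae_have 3 → 4 := by
    refine fun h => Digraph.forall_ne_inversePairs_iff.2 fun x y hxy => h ?_
    obtain ⟨n, z, h0, h1, h2, h3, hz⟩ := Digraph.exists_knottingWalk hxy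
    -- Both `z (2 * n)` and `z 1` equal `y`, so the knotting condition at the closing vertex is
    -- reflexivity.
    refine ⟨2 * n + 1, z, ⟨n, rfl⟩, hz, h3.trans h0.symm, ?_⟩
    rw [Nat.add_sub_cancel, h0, h1, h2]
    exact Digraph.Knotted.refl hxy.left_mem
  tfae_finish
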